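/- A $k$-graph is a pair $G=(X,\mathscr M)$ with $X$ a finite set and $\mathscr M$ a set of $k$-element subsets of $X$. An automorphism of $G$ is a bijection $X\to X$ that maps edges to edges and non-edges to non-edges; $G$ is asymmetric if the identity is its only automorphism, and symmetric otherwise. A $k$-subgraph of $G$ is a $k$-graph $(X',\mathscr M')$ with $X'\subseteq X$ and $\mathscr M'\subseteq\mathscr M$ (not necessarily induced). Call $G$ strongly minimal asymmetric if $G$ is asymmetric and every $k$-subgraph of $G$ that is different from $G$ and has at least two vertices is symmetric. For integers $k\ge 3$ and $t\ge k-2$ let $G^{\circ}_{k,t}$ be the $k$-graph with vertices $v_i$, $u_i$, $v_i^j$ ($1\le i\le tk$, $1\le j\le k-3$) and one more vertex $x$, all distinct, lower indices being read modulo $tk$, and with the edges $$E_i=\{v_i,u_i,v_i^1,\dots,v_i^{k-3},v_{i+1}\}\quad(1\le i\le tk),$$ $$E_{i,j}=\{v_i^j,v_{i+1}^j,\dots,v_{i+k-1}^j\}\quad(1\le j\le k-3,\ i=j+sk,\ 0\le s\le t-1),$$ $$E=\{v_1,u_1,v_1^1,\dots,v_1^{k-3},x\}.$$ Theorem. Let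 $k\ge 3$ be an integer. There are infinitely many pairwise non-isomorphic $k$-graphs that are strongly minimal asymmetric. In fact, for every $t\ge k-2$ the $k$-graph $G^{\circ}_{k,t}$ is strongly minimal asymmetric and every vertex of it lies in at most $3$ edges, and for distinct values $t\ge k-2$ the $k$-graphs $G^{\circ}_{k,t}$ are pairwise non-isomorphic. -/

import Mathlib

namespace Hypergraph

/-- A `k`-graph: a finite hypergraph all of whose edges have exactly `k` vertices. -/
def IsKGraph {α : Type*} (k : ℕ) (H : Hypergraph α) : Prop :=
  H.vertexSet.Finite ∧ ∀ e ∈ H.edgeSet, e.encard = k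

/-- `H'` is a (not necessarily induced) subhypergraph of `H`. -/
def IsSubhypergraph {α : Type*} (H' H : Hypergraph α) : Prop :=
  H'.vertexSet ⊆ H.vertexSet ∧ H'.edgeSet ⊆ H.edgeSet

/-- A bijection between the vertex sets that carries edges to edges and non-edges to non-edges. -/
def IsIso {α β : Type*} (H : Hypergraph α) (K : Hypergraph β)
    (φ : H.vertexSet ≃ K.vertexSet) : Prop :=
  ∀ e : Set H.vertexSet,
    Subtype.val '' e ∈ H.edgeSet ↔ Subtype.val '' (φ '' e) ∈ K.edgeSet

/-- Two hypergraphs are isomorphic. -/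
def Isomorphic {α β : Type*} (H : Hypergraph α) (K : Hypergraph β) : Prop :=
  ∃ φ : H.vertexSet ≃ K.vertexSet, IsIso H K φ

/-- The identity is the only automorphism. -/
def IsAsymmetric {α : Type*} (H : Hypergraph α) : Prop :=
  ∀ φ : Equiv.Perm H.vertexSet, IsIso H H φ → φ = 1

/-- There is a non-identity automorphism. -/
def IsSymmetric {α : Type*} (H : Hypergraph α) : Prop :=
  ∃ φ : Equiv.Perm H.vertexSet, IsIso H H φ ∧ φ ≠ 1

/-- A strongly minimal asymmetric `k`-graph: an asymmetric `k`-graph such that every other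
(not necessarily induced) `k`-subgraph with at least two vertices is symmetric. -/
def IsStronglyMinimalAsymmetric {α : Type*} (k : ℕ) (H : Hypergraph α) : Prop :=
  IsKGraph k H ∧ IsAsymmetric H ∧
    ∀ H' : Hypergraph α, IsKGraph k H' → IsSubhypergraph H' H → H' ≠ H →
      2 ≤ H'.vertexSet.encard → IsSymmetric H'

/-- The degree of a vertex: the number of edges that contain it. -/
noncomputable def edegree {α : Type*} (H : Hypergraph α) (a : α) : ℕ∞ :=
  {e | e ∈ H.edgeSet ∧ a ∈ e}.encard

/-- The vertices of the cyclic construction: `v i`, `u i` and `w j i`, where the subscript `i` is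
read modulo `t * k` and the colour `j` runs over `k - 3` values, and one more vertex `x`.
The value `j : Fin (k - 3)` stands for the colour `j + 1` in `{1, …, k - 3}`. -/
inductive CyclicVertex (k t : ℕ) : Type
  | v (i : ZMod (t * k)) : CyclicVertex k t
  | u (i : ZMod (t * k)) : CyclicVertex k t
  | w (j : Fin (k - 3)) (i : ZMod (t * k)) : CyclicVertex k t
  | x : CyclicVertex k t

namespace CyclicVertex

/-- The edge `{v i, u i, w 1 i, …, w (k - 3) i, v (i + 1)}`. -/
def cycleEdge (k t : ℕ) (i : ZMod (t * k)) : Set (CyclicVertex k t) :=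
  {v i, u i, v (i + 1)} ∪ Set.range (fun j => w j i)

/-- The edge `{w j i, w j (i + 1), …, w j (i + k - 1)}` for `i = j + s * k`, where `j` is counted
from `1`. -/
def colourEdge (k t : ℕ) (j : Fin (k - 3)) (s : ℕ) : Set (CyclicVertex k t) :=
  {a | ∃ r < k, a = w j (((j : ℕ) + 1 + s * k + r : ℕ) : ZMod (t * k))}

/-- The edge `{v 1, u 1, w 1 1, …, w (k - 3) 1, x}`. -/
def extraEdge (k t : ℕ) : Set (CyclicVertex k t) :=
  {v 1, u 1, x} ∪ Set.range (fun j => w j 1)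

end CyclicVertex

open CyclicVertex in
/-- The cyclic construction `G°_{k,t}`. -/
def cyclicGraph (k t : ℕ) : Hypergraph (CyclicVertex k t) where
  vertexSet := Set.univ
  edgeSet := Set.range (cycleEdge k t) ∪ {e | ∃ j, ∃ s < t, e = colourEdge k t j s} ∪
    {extraEdge k t}
  subset_vertexSet_of_mem_edgeSet' := fun _ _ => Set.subset_univ _

end Hypergraph

/-!
The graph `cyclicGraph k t` is a necklace of `t * k` edges `cycleEdge`, in which any two consecutive
ones share a vertex `v i`; the `k - 3` further vertices `w j i` of each of them are tied together
along the necklace by the edges `colourEdge`, and `extraEdge` marks the position `1`.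

*Asymmetry* (`eq_one_of_image_mem_iff`). The edges `extraEdge` and `cycleEdge k t 1` are the only
two that share more than one vertex, and only the first one contains a vertex of degree one, so both
are fixed by every automorphism. As `v 2` is the only vertex of the second edge that is not in the
first, it is fixed too. From there one walks around the necklace: no edge of the necklace is mapped
to a colour edge, because those contain no vertex of degree one, so each edge of the necklace is
determined by its predecessor and the vertex shared with it. Hence all edges of the necklace and all
`v i`, `u i` are fixed, and an automorphism can only permute the colours `j` of the vertices `w j i`
at each position `i`. It maps a block of one colour to a block of another colour at the same
positions, and the starting point of a block reveals its colour modulo `k`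
(`colour_eq_of_blocks_eq`).

*Minimality* (`isSymmetric_of_isSubhypergraph`). In a subgraph without symmetries no two vertices
lie in the same edges (`eq_of_twins`). If a colour edge is missing, this forces the edges of the
necklace at its positions to be missing. If an edge of the necklace is missing, it forces the
predecessor to be missing (at position `1` because `v 2` and `x` could be exchanged otherwise), and
so the whole necklace, then `extraEdge`, and finally all colour edges; but a graph without edges on
two vertices is symmetric. What is left is the case that exactly `extraEdge` is missing, and then
there is a rotation: by `k`, or by `1` if `k = 3`, where `t = 1` is possible and the rotation by `k`
may be trivial.

Graphs for distinct `t` are told apart by their numbers of vertices, `(k - 1) * (t * k) + 1`.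
-/

namespace Hypergraph

/-! ### Automorphisms from permutations of the ambient type -/

section General

variable {α β : Type*}

lemma isSymmetric_of_perm {H : Hypergraph α} (g : Equiv.Perm α)
    (hV : ∀ a, g a ∈ H.vertexSet ↔ a ∈ H.vertexSet)
    (hE : ∀ e ∈ H.edgeSet, g '' e ∈ H.edgeSet) (hE' : ∀ e ∈ H.edgeSet, g.symm '' e ∈ H.edgeSet)
    {a : α} (ha : a ∈ H.vertexSet) (hga : g a ≠ a) : H.IsSymmetric := by
  refine ⟨g.subtypePerm hV, fun e => ?_, fun h => hga ?_⟩
  · have key : Subtype.val '' (g.subtypePerm hV '' e) = g '' (Subtype.val '' e) := by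
      rw [Set.image_image, Set.image_image]
      rfl
    rw [key]
    refine ⟨hE _, fun h => ?_⟩
    simpa [Set.image_image] using hE' _ h
  · exact congrArg Subtype.val (DFunLike.congr_fun h ⟨a, ha⟩)

lemma isSymmetric_of_swap [DecidableEq α] {H : Hypergraph α} {a b : α} (hab : a ≠ b)
    (ha : a ∈ H.vertexSet) (hb : b ∈ H.vertexSet)
    (hE : ∀ e ∈ H.edgeSet, Equiv.swap a b '' e ∈ H.edgeSet) : H.IsSymmetric := by
  refine isSymmetric_of_perm (Equiv.swap a b) (fun c => ?_) hE (by simpa using hE) ha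
    (by simpa using hab.symm)
  rcases eq_or_ne c a with rfl | hca
  · simp [ha, hb]
  rcases eq_or_ne c b with rfl | hcb
  · simp [ha, hb]
  rw [Equiv.swap_apply_of_ne_of_ne hca hcb]

lemma image_swap_eq_self [DecidableEq α] {a b : α} {e : Set α} (h : a ∈ e ↔ b ∈ e) :
    Equiv.swap a b '' e = e := by
  ext c
  rw [Equiv.image_eq_preimage_symm, Equiv.symm_swap, Set.mem_preimage]
  rcases eq_or_ne c a with rfl | hca
  · simp [h]
  rcases eq_or_ne c b with rfl | hcb
  · simp [h]
  rw [Equiv.swap_apply_of_ne_of_ne hca hcb]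

/-- In a hypergraph without nontrivial automorphisms no two vertices are *twins*, that is, lie in
the same edges. -/
lemma eq_of_twins {H : Hypergraph α} (hH : ¬ H.IsSymmetric) {a b : α}
    (ha : a ∈ H.vertexSet) (hb : b ∈ H.vertexSet)
    (h : ∀ e ∈ H.edgeSet, (a ∈ e ↔ b ∈ e)) : a = b := by
  classical
  by_contra hab
  refine hH (isSymmetric_of_swap hab ha hb fun e he => ?_)
  rwa [image_swap_eq_self (h e he)]

lemma Isomorphic.card_eq {H : Hypergraph α} {K : Hypergraph β}
    (h : H.Isomorphic K) : Nat.card H.vertexSet = Nat.card K.vertexSet :=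
  Nat.card_congr h.choose

end General

/-! ### Incidence in the cyclic construction -/

namespace CyclicVertex

variable {k t : ℕ}

@[simp] lemma v_mem_cycleEdge {i i' : ZMod (t * k)} :
    v i ∈ cycleEdge k t i' ↔ i = i' ∨ i = i' + 1 := by simp [cycleEdge]

@[simp] lemma u_mem_cycleEdge {i i' : ZMod (t * k)} : u i ∈ cycleEdge k t i' ↔ i = i' := by
  simp [cycleEdge]

@[simp] lemma w_mem_cycleEdge {j : Fin (k - 3)} {i i' : ZMod (t * k)} :
    w j i ∈ cycleEdge k t i' ↔ i = i' := by simp [cycleEdge, eq_comm]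

@[simp] lemma x_notMem_cycleEdge {i : ZMod (t * k)} : x ∉ cycleEdge k t i := by simp [cycleEdge]

@[simp] lemma v_mem_extraEdge {i : ZMod (t * k)} : v i ∈ extraEdge k t ↔ i = 1 := by
  simp [extraEdge]

@[simp] lemma u_mem_extraEdge {i : ZMod (t * k)} : u i ∈ extraEdge k t ↔ i = 1 := by
  simp [extraEdge]

@[simp] lemma w_mem_extraEdge {j : Fin (k - 3)} {i : ZMod (t * k)} :
    w j i ∈ extraEdge k t ↔ i = 1 := by simp [extraEdge, eq_comm]

@[simp] lemma x_mem_extraEdge : x ∈ extraEdge k t := by simp [extraEdge]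

@[simp] lemma v_notMem_colourEdge {i : ZMod (t * k)} {j : Fin (k - 3)} {s : ℕ} :
    v i ∉ colourEdge k t j s := by simp [colourEdge]

@[simp] lemma u_notMem_colourEdge {i : ZMod (t * k)} {j : Fin (k - 3)} {s : ℕ} :
    u i ∉ colourEdge k t j s := by simp [colourEdge]

@[simp] lemma x_notMem_colourEdge {j : Fin (k - 3)} {s : ℕ} :
    x ∉ colourEdge k t j s := by simp [colourEdge]

/-- The edges of colour `j` cut the cycle of positions into `t` consecutive blocks of length `k`.
This is the number of the block that contains the position `i`. -/
def blockIndex (k t : ℕ) (j : Fin (k - 3)) (i : ZMod (t * k)) : ℕ :=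
  (i - ((j : ℕ) + 1 : ℕ)).val / k

lemma blockIndex_lt (hn : 0 < t * k) (j : Fin (k - 3)) (i : ZMod (t * k)) :
    blockIndex k t j i < t := by
  have : NeZero (t * k) := ⟨hn.ne'⟩
  exact Nat.div_lt_of_lt_mul (mul_comm t k ▸ ZMod.val_lt _)

lemma mul_add_lt {s r : ℕ} (hs : s < t) (hr : r < k) : s * k + r < t * k :=
  calc s * k + r < (s + 1) * k := by rw [add_mul]; omega
    _ ≤ t * k := Nat.mul_le_mul_right k hs

lemma w_mem_colourEdge {j j' : Fin (k - 3)} {i : ZMod (t * k)} {s : ℕ} (hs : s < t) :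
    w j' i ∈ colourEdge k t j s ↔ j' = j ∧ blockIndex k t j i = s := by
  have hk : 0 < k := by have := j.2; omega
  have : NeZero (t * k) := ⟨(Nat.mul_pos (by omega) hk).ne'⟩
  simp only [colourEdge, Set.mem_ofPred_eq, w.injEq, blockIndex]
  constructor
  · rintro ⟨r, hr, rfl, rfl⟩
    refine ⟨rfl, ?_⟩
    have h : (((j' : ℕ) + 1 + s * k + r : ℕ) : ZMod (t * k)) - ((j' : ℕ) + 1 : ℕ)
        = ((s * k + r : ℕ) : ZMod (t * k)) := by
      push_cast
      ring
    rw [h, ZMod.val_natCast_of_lt (mul_add_lt hs hr), mul_comm, Nat.mul_add_div hk,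
      Nat.div_eq_of_lt hr, add_zero]
  · rintro ⟨rfl, rfl⟩
    refine ⟨(i - ((j' : ℕ) + 1 : ℕ)).val % k, Nat.mod_lt _ hk, rfl, ?_⟩
    rw [add_assoc, Nat.div_add_mod', Nat.cast_add, ZMod.natCast_zmod_val]
    ring

/-- Shifting a position back by one changes its block in colour `j` exactly at the start of a
block, that is, at the positions that are congruent to the colour modulo `k`. There have to be two
blocks at least, as otherwise the only block has no boundary. -/
lemma blockIndex_sub_one_eq_iff (ht : 2 ≤ t) (j : Fin (k - 3)) (i : ZMod (t * k)) :
    blockIndex k t j (i - 1) = blockIndex k t j i ↔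
      ZMod.castHom (dvd_mul_left k t) (ZMod k) i ≠ ((j : ℕ) + 1 : ℕ) := by
  have hk : 3 < k := by have := j.2; omega
  have hn : 2 * k ≤ t * k := Nat.mul_le_mul_right k ht
  have : NeZero (t * k) := ⟨by omega⟩
  have : Fact (1 < t * k) := ⟨by omega⟩
  rw [blockIndex, blockIndex, sub_right_comm]
  have hcast : ZMod.castHom (dvd_mul_left k t) (ZMod k) i = ((j : ℕ) + 1 : ℕ) ↔
      k ∣ (i - ((j : ℕ) + 1 : ℕ)).val := by
    rw [← sub_eq_zero, ← map_natCast (ZMod.castHom (dvd_mul_left k t) (ZMod k)), ← map_sub]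
    conv_lhs => rw [← ZMod.natCast_zmod_val (i - (((j : ℕ) + 1 : ℕ) : ZMod (t * k)))]
    rw [map_natCast, ZMod.natCast_eq_zero_iff]
  rw [Ne, hcast]
  generalize i - (((j : ℕ) + 1 : ℕ) : ZMod (t * k)) = y
  by_cases hy : y = 0
  · subst hy
    have h1 : ((0 : ZMod (t * k)) - 1).val = t * k - 1 := by
      have aux : ∀ n : ℕ, 0 < n → ((0 : ZMod n) - 1).val = n - 1 := by
        rintro (_ | m) hm
        · omega
        · rw [zero_sub, ZMod.val_neg_one, Nat.add_sub_cancel]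
      exact aux _ (by omega)
    have h2 : 0 < (t * k - 1) / k := Nat.div_pos (by omega) (by omega)
    simp only [h1, ZMod.val_zero, Nat.zero_div, dvd_zero, not_true_eq_false, iff_false]
    omega
  · have hpos : 0 < y.val := Nat.pos_of_ne_zero fun h => hy ((ZMod.val_eq_zero y).1 h)
    have h1 : (y - 1).val = y.val - 1 := by
      rw [ZMod.val_sub (by rw [ZMod.val_one]; omega), ZMod.val_one]
    rw [h1]
    obtain ⟨m, hm⟩ : ∃ m, y.val = m + 1 := ⟨y.val - 1, by omega⟩
    rw [hm, Nat.add_sub_cancel, Nat.succ_div]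
    split_ifs with h <;> simp [h]

lemma colourEdge_add_period (j : Fin (k - 3)) (s : ℕ) :
    colourEdge k t j (s + t) = colourEdge k t j s := by
  have h : ((t : ZMod (t * k)) * k) = 0 := by
    rw [← Nat.cast_mul]; exact ZMod.natCast_self _
  simp only [colourEdge]
  push_cast
  simp only [add_mul, h, add_zero]

lemma colourEdge_mod (j : Fin (k - 3)) (s : ℕ) :
    colourEdge k t j (s % t) = colourEdge k t j s := by
  conv_rhs => rw [← Nat.mod_add_div' s t]
  generalize s / t = q
  induction q with
  | zero => simp
  | succ q ih => rw [ih, add_mul, one_mul, ← add_assoc, colourEdge_add_period]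

lemma w_start_mem_colourEdge (j : Fin (k - 3)) (s : ℕ) :
    w j (((j : ℕ) + 1 + s * k : ℕ) : ZMod (t * k)) ∈ colourEdge k t j s :=
  ⟨0, by have := j.2; omega, by simp⟩

end CyclicVertex

open CyclicVertex

variable {k t : ℕ}

lemma mem_edgeSet_cyclicGraph {e : Set (CyclicVertex k t)} :
    e ∈ (cyclicGraph k t).edgeSet ↔
      (∃ i, e = cycleEdge k t i) ∨ (∃ j, ∃ s < t, e = colourEdge k t j s) ∨
        e = extraEdge k t := by
  simp only [cyclicGraph, Set.mem_union, Set.mem_range, Set.mem_ofPred_eq, Set.mem_singleton_iff,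
    or_assoc, eq_comm]

lemma cycleEdge_mem (i : ZMod (t * k)) : cycleEdge k t i ∈ (cyclicGraph k t).edgeSet :=
  mem_edgeSet_cyclicGraph.2 (.inl ⟨i, rfl⟩)

lemma extraEdge_mem : extraEdge k t ∈ (cyclicGraph k t).edgeSet :=
  mem_edgeSet_cyclicGraph.2 (.inr (.inr rfl))

lemma colourEdge_mem {j : Fin (k - 3)} {s : ℕ} (hs : s < t) :
    colourEdge k t j s ∈ (cyclicGraph k t).edgeSet :=
  mem_edgeSet_cyclicGraph.2 (.inr (.inl ⟨j, s, hs, rfl⟩))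

lemma cycleEdge_injective : Function.Injective (cycleEdge k t) := fun i i' h => by
  have : u i ∈ cycleEdge k t i' := h ▸ u_mem_cycleEdge.2 rfl
  simpa using this

lemma cycleEdge_ne_extraEdge (i : ZMod (t * k)) : cycleEdge k t i ≠ extraEdge k t := fun h => by
  have : x ∈ cycleEdge k t i := h ▸ x_mem_extraEdge
  simp at this

lemma one_ne_zero_of_three_le (hn : 3 ≤ t * k) : (1 : ZMod (t * k)) ≠ 0 := by
  have : Fact (1 < t * k) := ⟨by omega⟩
  exact one_ne_zero

lemma two_ne_zero_of_three_le (hn : 3 ≤ t * k) : (1 + 1 : ZMod (t * k)) ≠ 0 := by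
  intro h
  have h2 : ((2 : ℕ) : ZMod (t * k)) = 0 := by push_cast; rw [← h]; norm_num
  rw [ZMod.natCast_eq_zero_iff] at h2
  exact absurd (Nat.le_of_dvd (by norm_num) h2) (by omega)

/-! ### Uniformity, degrees and the number of vertices -/

/-- The cyclic vertices other than `x` come in `t * k` groups of `k - 1`. -/
def cyclicVertexEquiv (k t : ℕ) :
    CyclicVertex k t ≃ Option ((Bool ⊕ Fin (k - 3)) × ZMod (t * k)) where
  toFun
    | .v i => some (.inl true, i)
    | .u i => some (.inl false, i)
    | .w j i => some (.inr j, i)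
    | .x => none
  invFun
    | some (.inl true, i) => .v i
    | some (.inl false, i) => .u i
    | some (.inr j, i) => .w j i
    | none => .x
  left_inv a := by cases a <;> rfl
  right_inv a := by rcases a with _ | ⟨(_ | _) | _, _⟩ <;> rfl

lemma finite_cyclicVertex (hn : 3 ≤ t * k) : Finite (CyclicVertex k t) := by
  have : NeZero (t * k) := ⟨by omega⟩
  exact Finite.of_equiv _ (cyclicVertexEquiv k t).symm

lemma card_vertexSet_cyclicGraph (hk : 3 ≤ k) (hn : 3 ≤ t * k) :
    Nat.card (cyclicGraph k t).vertexSet = (k - 1) * (t * k) + 1 := by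
  have : NeZero (t * k) := ⟨by omega⟩
  have h : (cyclicGraph k t).vertexSet = Set.univ := rfl
  rw [h, Nat.card_congr ((Equiv.Set.univ _).trans (cyclicVertexEquiv k t)),
    Finite.card_option, Nat.card_prod, Nat.card_zmod, Nat.card_sum,
    Nat.card_eq_fintype_card, Nat.card_eq_fintype_card, Fintype.card_bool, Fintype.card_fin]
  congr 2
  omega

lemma not_isomorphic_cyclicGraph {s : ℕ} (hk : 3 ≤ k) (hs : 1 ≤ s) (ht : 1 ≤ t) (hst : s ≠ t) :
    ¬ (cyclicGraph k s).Isomorphic (cyclicGraph k t) := fun h => by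
  have hcard := h.card_eq
  rw [card_vertexSet_cyclicGraph hk (by nlinarith), card_vertexSet_cyclicGraph hk (by nlinarith),
    Nat.add_right_cancel_iff] at hcard
  exact hst (Nat.eq_of_mul_eq_mul_right (by omega)
    (Nat.eq_of_mul_eq_mul_left (by omega) hcard))

lemma encard_range_w (i : ZMod (t * k)) :
    (Set.range fun j : Fin (k - 3) => w j i).encard = (k - 3 : ℕ) := by
  rw [← Set.image_univ, Set.InjOn.encard_image (fun a _ b _ h => by simpa using h),
    Set.encard_univ, ENat.card_eq_coe_fintype_card, Fintype.card_fin]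

lemma isKGraph_cyclicGraph (hk : 3 ≤ k) (hn : 3 ≤ t * k) :
    (cyclicGraph k t).IsKGraph k := by
  have := finite_cyclicVertex hn
  have h1 := one_ne_zero_of_three_le hn
  have h3 : (3 : ℕ∞) + (k - 3 : ℕ) = k := by
    have : 3 + (k - 3) = k := by omega
    exact_mod_cast this
  refine ⟨Set.toFinite _, fun e he => ?_⟩
  rcases mem_edgeSet_cyclicGraph.1 he with ⟨i, rfl⟩ | ⟨j, s, hs, rfl⟩ | rfl
  · rw [cycleEdge, Set.encard_union_eq, encard_range_w,
      Set.encard_eq_three.2 ⟨_, _, _, by simp, by simpa using h1, by simp, rfl⟩, h3]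
    rw [Set.disjoint_right]
    rintro _ ⟨j, rfl⟩
    simp
  · have himg : colourEdge k t j s =
        (fun r : ℕ => w j (((j : ℕ) + 1 + s * k + r : ℕ) : ZMod (t * k))) '' Set.Iio k := by
      ext a
      simp [colourEdge, eq_comm]
    rw [himg, Set.InjOn.encard_image, ← Finset.coe_Iio, Set.encard_coe_eq_coe_finsetCard,
      Nat.card_Iio]
    intro r hr r' hr' h
    have h' := (w.injEq ..).mp h |>.2
    push_cast at h'
    have h'' : (r : ZMod (t * k)) = r' := by simpa using h'
    have hkn : k ≤ t * k := Nat.le_mul_of_pos_left k (by omega)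
    have := congrArg ZMod.val h''
    rwa [ZMod.val_natCast_of_lt (hr.trans_le hkn), ZMod.val_natCast_of_lt (hr'.trans_le hkn)]
      at this
  · rw [extraEdge, Set.encard_union_eq, encard_range_w,
      Set.encard_eq_three.2 ⟨_, _, _, by simp, by simp, by simp, rfl⟩, h3]
    rw [Set.disjoint_right]
    rintro _ ⟨j, rfl⟩
    simp

lemma edegree_cyclicGraph_le (a : CyclicVertex k t) : (cyclicGraph k t).edegree a ≤ 3 := by
  suffices h : ∃ e₁ e₂, ∀ e ∈ (cyclicGraph k t).edgeSet, a ∈ e →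
      e = e₁ ∨ e = e₂ ∨ e = extraEdge k t by
    obtain ⟨e₁, e₂, h⟩ := h
    have hsub : {e | e ∈ (cyclicGraph k t).edgeSet ∧ a ∈ e} ⊆ {e₁, e₂, extraEdge k t} :=
      fun e he => h e he.1 he.2
    refine (Set.encard_le_encard hsub).trans ?_
    refine (Set.encard_insert_le _ _).trans ?_
    refine (add_le_add_left (Set.encard_insert_le _ _) 1).trans ?_
    rw [Set.encard_singleton]
    norm_num
  cases a with
  | v i =>
    refine ⟨cycleEdge k t i, cycleEdge k t (i - 1), fun e he ha => ?_⟩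
    rcases mem_edgeSet_cyclicGraph.1 he with ⟨i', rfl⟩ | ⟨j, s, hs, rfl⟩ | rfl
    · rcases v_mem_cycleEdge.1 ha with rfl | rfl <;> simp
    · simp at ha
    · simp
  | u i =>
    refine ⟨cycleEdge k t i, cycleEdge k t i, fun e he ha => ?_⟩
    rcases mem_edgeSet_cyclicGraph.1 he with ⟨i', rfl⟩ | ⟨j, s, hs, rfl⟩ | rfl
    · rw [u_mem_cycleEdge.1 ha]; simp
    · simp at ha
    · simp
  | w j i =>
    refine ⟨cycleEdge k t i, colourEdge k t j (blockIndex k t j i), fun e he ha => ?_⟩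
    rcases mem_edgeSet_cyclicGraph.1 he with ⟨i', rfl⟩ | ⟨j', s, hs, rfl⟩ | rfl
    · rw [w_mem_cycleEdge.1 ha]; simp
    · obtain ⟨rfl, rfl⟩ := (w_mem_colourEdge hs).1 ha
      simp
    · simp
  | x =>
    refine ⟨extraEdge k t, extraEdge k t, fun e he ha => ?_⟩
    rcases mem_edgeSet_cyclicGraph.1 he with ⟨i', rfl⟩ | ⟨j', s, hs, rfl⟩ | rfl
    · simp at ha
    · simp at ha
    · simp

/-! ### Proper subgraphs are symmetric -/

namespace CyclicVertex

/-- The shift of all positions by `r`, with `x` fixed. -/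
def rotate (k t : ℕ) (r : ZMod (t * k)) : Equiv.Perm (CyclicVertex k t) where
  toFun
    | .v i => .v (i + r)
    | .u i => .u (i + r)
    | .w j i => .w j (i + r)
    | .x => .x
  invFun
    | .v i => .v (i + -r)
    | .u i => .u (i + -r)
    | .w j i => .w j (i + -r)
    | .x => .x
  left_inv a := by cases a <;> simp
  right_inv a := by cases a <;> simp

lemma rotate_symm (r : ZMod (t * k)) : (rotate k t r).symm = rotate k t (-r) := by
  ext a
  cases a <;> rfl

lemma rotate_image_cycleEdge (r i : ZMod (t * k)) :
    rotate k t r '' cycleEdge k t i = cycleEdge k t (i + r) := by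
  simp only [cycleEdge, Set.image_union, Set.image_insert_eq, Set.image_singleton,
    ← Set.range_comp]
  rw [add_right_comm i r 1]
  rfl

lemma rotate_image_colourEdge (c : ℕ) (j : Fin (k - 3)) (s : ℕ) :
    rotate k t ((c * k : ℕ) : ZMod (t * k)) '' colourEdge k t j s = colourEdge k t j (s + c) := by
  have h : ∀ r : ℕ, rotate k t ((c * k : ℕ) : ZMod (t * k))
      (w j (((j : ℕ) + 1 + s * k + r : ℕ) : ZMod (t * k))) =
      w j (((j : ℕ) + 1 + (s + c) * k + r : ℕ) : ZMod (t * k)) := fun r => by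
    change w j _ = _
    refine congrArg (w j) ?_
    push_cast
    ring
  ext a
  simp only [colourEdge, Set.mem_image, Set.mem_ofPred_eq]
  constructor
  · rintro ⟨_, ⟨r, hr, rfl⟩, rfl⟩
    exact ⟨r, hr, h r⟩
  · rintro ⟨r, hr, rfl⟩
    exact ⟨_, ⟨r, hr, rfl⟩, h r⟩

end CyclicVertex

/-- All edges but `extraEdge` are permuted by the rotations through multiples of `k`, and by all
rotations if there are no colours. -/
lemma rotate_image_mem (ht : 1 ≤ t) {r : ZMod (t * k)} (hr : k = 3 ∨ ∃ c : ℕ, r = (c * k : ℕ))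
    {e : Set (CyclicVertex k t)} (he : e ∈ (cyclicGraph k t).edgeSet) (hne : e ≠ extraEdge k t) :
    rotate k t r '' e ∈ (cyclicGraph k t).edgeSet ∧ rotate k t r '' e ≠ extraEdge k t := by
  rcases mem_edgeSet_cyclicGraph.1 he with ⟨i, rfl⟩ | ⟨j, s, hs, rfl⟩ | rfl
  · rw [rotate_image_cycleEdge]
    exact ⟨cycleEdge_mem _, cycleEdge_ne_extraEdge _⟩
  · obtain ⟨c, rfl⟩ := hr.resolve_left (by have := j.2; omega)
    rw [rotate_image_colourEdge, ← colourEdge_mod]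
    refine ⟨colourEdge_mem (Nat.mod_lt _ ht), fun h => ?_⟩
    have : x ∈ colourEdge k t j ((s + c) % t) := h ▸ x_mem_extraEdge
    simp at this
  · exact absurd rfl hne

/-- Minimality: if a proper subgraph had no symmetry, the absence of one edge would force
that of all edges, unless only `extraEdge` is missing, and then there is a rotation. -/
lemma isSymmetric_of_isSubhypergraph (hk : 3 ≤ k) (ht : k - 2 ≤ t)
    {H : Hypergraph (CyclicVertex k t)} (hsub : H.IsSubhypergraph (cyclicGraph k t))
    (hne : H ≠ cyclicGraph k t) (hcard : 2 ≤ H.vertexSet.encard) : H.IsSymmetric := by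
  classical
  have ht1 : 1 ≤ t := by omega
  have hn : 3 ≤ t * k := hk.trans (Nat.le_mul_of_pos_left k ht1)
  have : NeZero (t * k) := ⟨by omega⟩
  have h10 := one_ne_zero_of_three_le hn
  have hcases : ∀ e ∈ H.edgeSet, (∃ i, e = cycleEdge k t i) ∨
      (∃ j, ∃ s < t, e = colourEdge k t j s) ∨ e = extraEdge k t :=
    fun e he => mem_edgeSet_cyclicGraph.1 (hsub.2 he)
  have hV : ∀ {e : Set (CyclicVertex k t)} {a}, e ∈ H.edgeSet → a ∈ e → a ∈ H.vertexSet :=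
    fun he ha => H.subset_vertexSet_of_mem_edgeSet' he ha
  by_contra hH
  -- Without `colourEdge k t j s`, the vertices `w j i` and `u i` are twins for `i` in block `s`.
  have hcolour : ∀ j, ∀ s < t, colourEdge k t j s ∉ H.edgeSet →
      ∀ i, blockIndex k t j i = s → cycleEdge k t i ∉ H.edgeSet := by
    intro j s hs hmiss i hi hcyc
    have : u i = w j i := by
      refine eq_of_twins hH (hV hcyc (by simp)) (hV hcyc (by simp)) fun e he => ?_
      rcases hcases e he with ⟨i', rfl⟩ | ⟨j', s', hs', rfl⟩ | rfl
      · simp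
      · rw [w_mem_colourEdge hs']
        simp only [u_notMem_colourEdge, false_iff]
        rintro ⟨rfl, rfl⟩
        exact hmiss (hi ▸ he)
      · simp
    simp at this
  -- Without the edge at `1`, the vertices `u 1` and `x` are twins.
  have hextra : cycleEdge k t 1 ∉ H.edgeSet → extraEdge k t ∉ H.edgeSet := by
    intro hmiss hex
    have : (u 1 : CyclicVertex k t) = x := by
      refine eq_of_twins hH (hV hex (by simp)) (hV hex (by simp)) fun e he => ?_
      rcases hcases e he with ⟨i', rfl⟩ | ⟨j', s', hs', rfl⟩ | rfl
      · simp only [u_mem_cycleEdge, x_notMem_cycleEdge, iff_false]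
        rintro rfl
        exact hmiss he
      · simp
      · simp
    simp at this
  -- The set of missing edges of the cycle is closed under predecessors.
  have hpred : ∀ i, cycleEdge k t (i + 1) ∉ H.edgeSet → cycleEdge k t i ∉ H.edgeSet := by
    intro i hmiss hcyc
    by_cases hi : i = 1 ∧ extraEdge k t ∈ H.edgeSet
    · obtain ⟨rfl, hex⟩ := hi
      -- Here `v 2` and `x` lie in one edge each, and these two edges are swapped with them.
      refine hH (isSymmetric_of_swap (a := v (1 + 1)) (b := x) (by simp)
        (hV hcyc (by simp)) (hV hex (by simp)) fun e he => ?_)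
      have himg : Equiv.swap (v (1 + 1)) x '' cycleEdge k t 1 = extraEdge k t := by
        ext a
        rw [Equiv.image_eq_preimage_symm, Equiv.symm_swap, Set.mem_preimage]
        rcases eq_or_ne a x with rfl | hax
        · simp
        rcases eq_or_ne a (v (1 + 1)) with rfl | hav
        · simp [h10]
        rw [Equiv.swap_apply_of_ne_of_ne hav hax]
        cases a with
        | v i => simp [show i ≠ 1 + 1 from fun h => hav (h ▸ rfl)]
        | u i => simp
        | w j i => simp
        | x => simp at hax
      rcases hcases e he with ⟨i', rfl⟩ | ⟨j', s', hs', rfl⟩ | rfl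
      · rcases eq_or_ne i' 1 with rfl | hi'
        · rwa [himg]
        · rwa [image_swap_eq_self]
          simp only [v_mem_cycleEdge, add_left_inj, x_notMem_cycleEdge, iff_false, not_or]
          refine ⟨?_, hi'.symm⟩
          rintro rfl
          exact hmiss he
      · rwa [image_swap_eq_self (by simp)]
      · rw [← himg, ← Set.image_comp]
        simpa using hcyc
    · have : v (i + 1) = u i := by
        refine eq_of_twins hH (hV hcyc (by simp)) (hV hcyc (by simp)) fun e he => ?_
        rcases hcases e he with ⟨i', rfl⟩ | ⟨j', s', hs', rfl⟩ | rfl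
        · simp only [v_mem_cycleEdge, add_left_inj, u_mem_cycleEdge, or_iff_right_iff_imp]
          rintro rfl
          exact absurd he hmiss
        · simp
        · have h1 : i ≠ 1 := fun h => hi ⟨h, he⟩
          have h2 : i ≠ 0 := by
            rintro rfl
            rw [zero_add] at hmiss
            exact hextra hmiss he
          simp [h1, h2]
      simp at this
  by_cases hall : ∀ i, cycleEdge k t i ∈ H.edgeSet
  · have hallc : ∀ j, ∀ s < t, colourEdge k t j s ∈ H.edgeSet := by
      intro j s hs
      by_contra hmiss
      exact hcolour j s hs hmiss _ ((w_mem_colourEdge hs).1 (w_start_mem_colourEdge j s)).2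
        (hall _)
    by_cases hex : extraEdge k t ∈ H.edgeSet
    · have hE : H.edgeSet = (cyclicGraph k t).edgeSet := by
        refine hsub.2.antisymm fun e he => ?_
        rcases mem_edgeSet_cyclicGraph.1 he with ⟨i, rfl⟩ | ⟨j, s, hs, rfl⟩ | rfl
        exacts [hall i, hallc j s hs, hex]
      refine hne (Hypergraph.ext (hsub.1.antisymm fun a _ => ?_) hE)
      cases a with
      | v i => exact hV (hall i) (by simp)
      | u i => exact hV (hall i) (by simp)
      | w j i => exact hV (hall i) (by simp)
      | x => exact hV hex (by simp)
    · -- Only the extra edge is missing, and there is a rotation.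
      have hmem : ∀ e, e ∈ H.edgeSet ↔ e ∈ (cyclicGraph k t).edgeSet ∧ e ≠ extraEdge k t := by
        refine fun e => ⟨fun he => ⟨hsub.2 he, fun h => hex (h ▸ he)⟩, fun ⟨he, hne'⟩ => ?_⟩
        rcases mem_edgeSet_cyclicGraph.1 he with ⟨i, rfl⟩ | ⟨j, s, hs, rfl⟩ | rfl
        exacts [hall i, hallc j s hs, absurd rfl hne']
      obtain ⟨r, hr0, hr, hr'⟩ : ∃ r : ZMod (t * k), r ≠ 0 ∧
          (k = 3 ∨ ∃ c : ℕ, r = (c * k : ℕ)) ∧ (k = 3 ∨ ∃ c : ℕ, -r = (c * k : ℕ)) := by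
        rcases hk.eq_or_lt' with h3 | h3
        · exact ⟨1, h10, .inl h3, .inl h3⟩
        · refine ⟨(k : ℕ), ?_, .inr ⟨1, by simp⟩, .inr ⟨t - 1, ?_⟩⟩
          · rw [Ne, ZMod.natCast_eq_zero_iff]
            intro h
            have h1 := Nat.le_of_dvd (by omega) h
            have h2 : 2 * k ≤ t * k := Nat.mul_le_mul_right k (by omega)
            omega
          · rw [neg_eq_iff_add_eq_zero, add_comm, ← Nat.cast_add, ← Nat.succ_mul,
              Nat.succ_eq_add_one, Nat.sub_add_cancel ht1, ZMod.natCast_self]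
      refine hH (isSymmetric_of_perm (rotate k t r) (fun a => ?_) (fun e he => ?_)
        (fun e he => ?_) (hV (hall 0) (v_mem_cycleEdge.2 (.inl rfl))) (fun h => hr0 ?_))
      · cases a with
        | v i =>
          exact iff_of_true (hV (hall (i + r)) (v_mem_cycleEdge.2 (.inl rfl)))
              (hV (hall i) (by simp))
        | u i =>
          exact iff_of_true (hV (hall (i + r)) (u_mem_cycleEdge.2 rfl))
              (hV (hall i) (by simp))
        | w j i =>
          exact iff_of_true (hV (hall (i + r)) (w_mem_cycleEdge.2 rfl))
              (hV (hall i) (by simp))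
        | x => rfl
      · rw [hmem] at he ⊢
        exact rotate_image_mem ht1 hr he.1 he.2
      · rw [hmem] at he ⊢
        rw [rotate_symm]
        exact rotate_image_mem ht1 hr' he.1 he.2
      · simpa using (v.injEq ..).mp h
  · push Not at hall
    obtain ⟨i₀, hi₀⟩ := hall
    have hnone : ∀ i, cycleEdge k t i ∉ H.edgeSet := by
      have hback : ∀ m : ℕ, cycleEdge k t (i₀ - m) ∉ H.edgeSet := by
        intro m
        induction m with
        | zero => simpa using hi₀
        | succ m ih =>
          refine hpred _ ?_
          convert ih using 3
          push_cast
          ring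
      intro i
      have := hback (i₀ - i).val
      rwa [ZMod.natCast_zmod_val, sub_sub_cancel] at this
    -- The remaining edges are disjoint, so any two vertices of an edge are twins.
    have hnocolour : ∀ j, ∀ s < t, colourEdge k t j s ∉ H.edgeSet := by
      intro j s hs hmem
      have hkn : k ≤ t * k := Nat.le_mul_of_pos_left k ht1
      have h0 : w j (((j : ℕ) + 1 + s * k : ℕ) : ZMod (t * k)) ∈ colourEdge k t j s :=
        w_start_mem_colourEdge j s
      have h1 : w j (((j : ℕ) + 1 + s * k + 1 : ℕ) : ZMod (t * k)) ∈ colourEdge k t j s :=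
        ⟨1, by omega, rfl⟩
      have := eq_of_twins hH (hV hmem h0) (hV hmem h1) fun e he => by
        rcases hcases e he with ⟨i', rfl⟩ | ⟨j', s', hs', rfl⟩ | rfl
        · exact absurd he (hnone i')
        · rw [w_mem_colourEdge hs] at h0 h1
          rw [w_mem_colourEdge hs', w_mem_colourEdge hs']
          refine and_congr_right fun hj => ?_
          rw [← hj, h0.2, h1.2]
        · exact absurd he (hextra (hnone 1))
      simp [h10] at this
    obtain ⟨a, b, ha, hb, hab⟩ := Set.one_lt_encard_iff.1 (lt_of_lt_of_le (by norm_num) hcard)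
    refine hab (eq_of_twins hH ha hb fun e he => ?_)
    rcases hcases e he with ⟨i', rfl⟩ | ⟨j', s', hs', rfl⟩ | rfl
    · exact absurd he (hnone i')
    · exact absurd he (hnocolour j' s' hs')
    · exact absurd he (hextra (hnone 1))

/-! ### Asymmetry -/

lemma eq_v_of_mem_cycleEdge_of_mem_cycleEdge {i i' : ZMod (t * k)} (hi : i ≠ i')
    {a : CyclicVertex k t} (ha : a ∈ cycleEdge k t i) (ha' : a ∈ cycleEdge k t i') :
    (i' = i + 1 ∧ a = v i') ∨ (i = i' + 1 ∧ a = v i) := by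
  cases a <;> simp at ha ha' ⊢ <;> grind

lemma eq_w_of_mem_cycleEdge_of_mem_colourEdge {i : ZMod (t * k)} {j : Fin (k - 3)} {s : ℕ}
    (hs : s < t) {a : CyclicVertex k t} (ha : a ∈ cycleEdge k t i)
    (ha' : a ∈ colourEdge k t j s) : a = w j i := by
  cases a with
  | w j' i' => rw [w_mem_cycleEdge.1 ha, ((w_mem_colourEdge hs).1 ha').1]
  | _ => simp at ha'

lemma eq_w_of_mem_extraEdge_of_mem_colourEdge {j : Fin (k - 3)} {s : ℕ}
    (hs : s < t) {a : CyclicVertex k t} (ha : a ∈ extraEdge k t)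
    (ha' : a ∈ colourEdge k t j s) : a = w j 1 := by
  cases a with
  | w j' i' => rw [w_mem_extraEdge.1 ha, ((w_mem_colourEdge hs).1 ha').1]
  | _ => simp at ha'

lemma eq_v_of_mem_cycleEdge_of_mem_extraEdge {i : ZMod (t * k)} (hi : i ≠ 1)
    {a : CyclicVertex k t} (ha : a ∈ cycleEdge k t i) (ha' : a ∈ extraEdge k t) : a = v 1 := by
  cases a <;> simp at ha ha' ⊢ <;> grind

lemma colourEdge_eq_of_mem {j j' : Fin (k - 3)} {s s' : ℕ} (hs : s < t) (hs' : s' < t)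
    {a : CyclicVertex k t} (ha : a ∈ colourEdge k t j s) (ha' : a ∈ colourEdge k t j' s') :
    colourEdge k t j s = colourEdge k t j' s' := by
  cases a with
  | w j₀ i =>
    obtain ⟨rfl, rfl⟩ := (w_mem_colourEdge hs).1 ha
    obtain ⟨rfl, rfl⟩ := (w_mem_colourEdge hs').1 ha'
    rfl
  | _ => simp at ha'

/-- The extra edge and the edge of the cycle at `1` are the only edges that share two vertices. -/
lemma eq_extraEdge_or_eq_cycleEdge_one (hn : 3 ≤ t * k) {e e' : Set (CyclicVertex k t)}
    (he : e ∈ (cyclicGraph k t).edgeSet) (he' : e' ∈ (cyclicGraph k t).edgeSet) (hne : e ≠ e')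
    {a b : CyclicVertex k t} (hab : a ≠ b) (ha : a ∈ e) (hb : b ∈ e) (ha' : a ∈ e')
    (hb' : b ∈ e') : e = extraEdge k t ∨ e = cycleEdge k t 1 := by
  rcases mem_edgeSet_cyclicGraph.1 he with ⟨i, rfl⟩ | ⟨j, s, hs, rfl⟩ | rfl
  · rcases mem_edgeSet_cyclicGraph.1 he' with ⟨i', rfl⟩ | ⟨j', s', hs', rfl⟩ | rfl
    · have hi : i ≠ i' := fun h => hne (h ▸ rfl)
      have h2 := two_ne_zero_of_three_le hn
      rcases eq_v_of_mem_cycleEdge_of_mem_cycleEdge hi ha ha' with ⟨h, rfl⟩ | ⟨h, rfl⟩ <;>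
        rcases eq_v_of_mem_cycleEdge_of_mem_cycleEdge hi hb hb' with ⟨h', rfl⟩ | ⟨h', rfl⟩ <;>
          first
          | exact absurd rfl hab
          | exact absurd (by grind) h2
    · exact absurd ((eq_w_of_mem_cycleEdge_of_mem_colourEdge hs' ha ha').trans
        (eq_w_of_mem_cycleEdge_of_mem_colourEdge hs' hb hb').symm) hab
    · by_cases hi : i = 1
      · exact .inr (hi ▸ rfl)
      · exact absurd ((eq_v_of_mem_cycleEdge_of_mem_extraEdge hi ha ha').trans
          (eq_v_of_mem_cycleEdge_of_mem_extraEdge hi hb hb').symm) hab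
  · rcases mem_edgeSet_cyclicGraph.1 he' with ⟨i', rfl⟩ | ⟨j', s', hs', rfl⟩ | rfl
    · exact absurd ((eq_w_of_mem_cycleEdge_of_mem_colourEdge hs ha' ha).trans
        (eq_w_of_mem_cycleEdge_of_mem_colourEdge hs hb' hb).symm) hab
    · exact absurd (colourEdge_eq_of_mem hs hs' ha ha') hne
    · exact absurd ((eq_w_of_mem_extraEdge_of_mem_colourEdge hs ha' ha).trans
        (eq_w_of_mem_extraEdge_of_mem_colourEdge hs hb' hb).symm) hab
  · exact .inl rfl

/-- A vertex that lies in at most one edge. -/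
def IsLeaf {α : Type*} (H : Hypergraph α) (a : α) : Prop :=
  ∀ e ∈ H.edgeSet, ∀ e' ∈ H.edgeSet, a ∈ e → a ∈ e' → e = e'

lemma isLeaf_x : (cyclicGraph k t).IsLeaf x := by
  have h : ∀ e ∈ (cyclicGraph k t).edgeSet, x ∈ e → e = extraEdge k t := by
    intro e he hx
    rcases mem_edgeSet_cyclicGraph.1 he with ⟨i, rfl⟩ | ⟨j, s, hs, rfl⟩ | rfl
    · simp at hx
    · simp at hx
    · rfl
  exact fun e he e' he' hx hx' => (h e he hx).trans (h e' he' hx').symm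

lemma isLeaf_u {i : ZMod (t * k)} (hi : i ≠ 1) : (cyclicGraph k t).IsLeaf (u i) := by
  have h : ∀ e ∈ (cyclicGraph k t).edgeSet, u i ∈ e → e = cycleEdge k t i := by
    intro e he hx
    rcases mem_edgeSet_cyclicGraph.1 he with ⟨i, rfl⟩ | ⟨j, s, hs, rfl⟩ | rfl
    · rw [u_mem_cycleEdge.1 hx]
    · simp at hx
    · exact absurd (u_mem_extraEdge.1 hx) hi
  exact fun e he e' he' hx hx' => (h e he hx).trans (h e' he' hx').symm

lemma not_isLeaf_of_mem_colourEdge {j : Fin (k - 3)} {s : ℕ} (hs : s < t)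
    {a : CyclicVertex k t} (ha : a ∈ colourEdge k t j s) : ¬ (cyclicGraph k t).IsLeaf a := by
  intro h
  cases a with
  | w j' i =>
    have h' := h _ (colourEdge_mem hs) _ (cycleEdge_mem i) ha (by simp)
    have : u i ∈ colourEdge k t j s := h' ▸ u_mem_cycleEdge.2 rfl
    simp at this
  | _ => simp at ha

lemma not_isLeaf_of_mem_cycleEdge_one (hn : 3 ≤ t * k)
    {a : CyclicVertex k t} (ha : a ∈ cycleEdge k t 1) : ¬ (cyclicGraph k t).IsLeaf a := by
  intro h
  by_cases hex : a ∈ extraEdge k t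
  · exact cycleEdge_ne_extraEdge 1 (h _ (cycleEdge_mem 1) _ extraEdge_mem ha hex)
  · have hav : a = v (1 + 1) := by
      cases a <;> simp at ha hex ⊢ <;> grind
    subst hav
    have := cycleEdge_injective
      (h _ (cycleEdge_mem 1) _ (cycleEdge_mem (1 + 1)) (by simp) (by simp))
    exact one_ne_zero_of_three_le hn (by simpa using this)

/-- The colours are rigid: a block of colour `j` and a block of colour `j'` that occupy the same
positions start at the same position, which determines the colour modulo `k`. -/
lemma colour_eq_of_blocks_eq (ht : 2 ≤ t) {j j' : Fin (k - 3)} {s s' : ℕ} (hs : s < t)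
    (h : ∀ i, blockIndex k t j i = s ↔ blockIndex k t j' i = s') : j = j' := by
  set i : ZMod (t * k) := (((j : ℕ) + 1 + s * k : ℕ) : ZMod (t * k)) with hi
  have hblock : blockIndex k t j i = s := ((w_mem_colourEdge hs).1 (w_start_mem_colourEdge j s)).2
  have hcast : ZMod.castHom (dvd_mul_left k t) (ZMod k) i = ((j : ℕ) + 1 : ℕ) := by
    rw [hi, map_natCast]
    simp
  have hstart : blockIndex k t j (i - 1) ≠ s := by
    rw [← hblock, Ne, blockIndex_sub_one_eq_iff ht]
    exact not_not.2 hcast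
  rw [Ne, h, ← (h i).1 hblock, blockIndex_sub_one_eq_iff ht, not_not, hcast] at hstart
  have := congrArg ZMod.val hstart
  rw [ZMod.val_natCast_of_lt (by omega), ZMod.val_natCast_of_lt (by omega)] at this
  exact Fin.ext (by omega)

/-- Asymmetry, for permutations of the ambient type instead of the vertex set. -/
lemma eq_one_of_image_mem_iff (ht : k - 2 ≤ t) (hn : 3 ≤ t * k)
    (f : Equiv.Perm (CyclicVertex k t))
    (hf : ∀ e, e ∈ (cyclicGraph k t).edgeSet ↔ f '' e ∈ (cyclicGraph k t).edgeSet) :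
    f = 1 := by
  have : NeZero (t * k) := ⟨by omega⟩
  have h10 := one_ne_zero_of_three_le hn
  have hinj : Function.Injective (f '' ·) := f.injective.image_injective
  have hmem : ∀ {a e}, f a ∈ f '' e ↔ a ∈ e := f.injective.mem_set_image
  have hpre : ∀ e ∈ (cyclicGraph k t).edgeSet, ∃ e' ∈ (cyclicGraph k t).edgeSet, f '' e' = e := by
    intro e he
    have h : f '' (f.symm '' e) = e := f.image_symm_image e
    exact ⟨_, (hf _).2 (h.symm ▸ he), h⟩
  have hleaf : ∀ {a}, (cyclicGraph k t).IsLeaf a → (cyclicGraph k t).IsLeaf (f a) := by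
    intro a ha e he e' he' h h'
    obtain ⟨d, hd, rfl⟩ := hpre e he
    obtain ⟨d', hd', rfl⟩ := hpre e' he'
    rw [ha d hd d' hd' (hmem.1 h) (hmem.1 h')]
  -- The extra edge contains the leaf `x`, and the edge of the cycle at `1` contains no leaf.
  have hex : f '' extraEdge k t = extraEdge k t := by
    refine (eq_extraEdge_or_eq_cycleEdge_one hn ((hf _).1 extraEdge_mem)
      ((hf _).1 (cycleEdge_mem 1)) (fun h => cycleEdge_ne_extraEdge 1 (hinj h).symm)
      (f.injective.ne (show v 1 ≠ u 1 by simp)) (hmem.2 (by simp)) (hmem.2 (by simp))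
      (hmem.2 (by simp)) (hmem.2 (by simp))).resolve_right fun h => ?_
    exact not_isLeaf_of_mem_cycleEdge_one hn (h ▸ hmem.2 x_mem_extraEdge) (hleaf isLeaf_x)
  have hone : f '' cycleEdge k t 1 = cycleEdge k t 1 := by
    refine (eq_extraEdge_or_eq_cycleEdge_one hn ((hf _).1 (cycleEdge_mem 1))
      ((hf _).1 extraEdge_mem) (fun h => cycleEdge_ne_extraEdge 1 (hinj h))
      (f.injective.ne (show v 1 ≠ u 1 by simp)) (hmem.2 (by simp)) (hmem.2 (by simp))
      (hmem.2 (by simp)) (hmem.2 (by simp))).resolve_left fun h => ?_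
    exact cycleEdge_ne_extraEdge 1 (hinj (h.trans hex.symm))
  have hx : f x = x := by
    have h1 : f x ∈ extraEdge k t := hex ▸ hmem.2 x_mem_extraEdge
    have h2 : f x ∉ cycleEdge k t 1 := by rw [← hone, hmem]; simp
    generalize f x = a at h1 h2
    cases a <;> simp at h1 h2 ⊢ <;> grind
  have hv2 : f (v (1 + 1)) = v (1 + 1) := by
    have h1 : f (v (1 + 1)) ∈ cycleEdge k t 1 := by rw [← hone, hmem]; simp
    have h2 : f (v (1 + 1)) ∉ extraEdge k t := by rw [← hex, hmem]; simp [h10]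
    generalize f (v (1 + 1)) = a at h1 h2
    cases a <;> simp at h1 h2 ⊢ <;> grind
  have hcyc : ∀ i, ∃ i', f '' cycleEdge k t i = cycleEdge k t i' := by
    intro i
    by_cases hi : i = 1
    · exact ⟨1, hi ▸ hone⟩
    rcases mem_edgeSet_cyclicGraph.1 ((hf _).1 (cycleEdge_mem i)) with h | ⟨j, s, hs, h⟩ | h
    · exact h
    · exact absurd (hleaf (isLeaf_u hi))
        (not_isLeaf_of_mem_colourEdge hs (h ▸ hmem.2 (u_mem_cycleEdge.2 rfl)))
    · exact absurd (hinj (h.trans hex.symm)) (cycleEdge_ne_extraEdge i)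
  -- Walk around the cycle, starting from the fixed vertex `v 2`.
  have hstep : ∀ i, f (v (i + 1)) = v (i + 1) → f '' cycleEdge k t i = cycleEdge k t i →
      f (v (i + 1 + 1)) = v (i + 1 + 1) ∧
        f '' cycleEdge k t (i + 1) = cycleEdge k t (i + 1) := by
    intro i hv he
    have he' : f '' cycleEdge k t (i + 1) = cycleEdge k t (i + 1) := by
      obtain ⟨i', h⟩ := hcyc (i + 1)
      have h1 : v (i + 1) ∈ cycleEdge k t i' := by rw [← h, ← hv, hmem]; simp
      rcases v_mem_cycleEdge.1 h1 with rfl | h2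
      · exact h
      · rw [← add_right_cancel h2, ← he] at h
        exact absurd (cycleEdge_injective (hinj h)) (by simp [h10])
    refine ⟨?_, he'⟩
    obtain ⟨i', h⟩ := hcyc (i + 1 + 1)
    have h1 : f (v (i + 1 + 1)) ∈ cycleEdge k t (i + 1) := by rw [← he', hmem]; simp
    have h2 : f (v (i + 1 + 1)) ∈ cycleEdge k t i' := by rw [← h, hmem]; simp
    have h3 : i + 1 ≠ i' := by
      rintro rfl
      exact absurd (cycleEdge_injective (hinj (h.trans he'.symm))) (by simp [h10])
    rcases eq_v_of_mem_cycleEdge_of_mem_cycleEdge h3 h1 h2 with ⟨rfl, h4⟩ | ⟨-, h4⟩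
    · exact h4
    · rw [← hv] at h4
      exact absurd (f.injective h4) (by simp [h10])
  have hwalk : ∀ m : ℕ, f (v (1 + m + 1)) = v (1 + m + 1) ∧
      f '' cycleEdge k t (1 + m) = cycleEdge k t (1 + m) := by
    intro m
    induction m with
    | zero => simpa using ⟨hv2, hone⟩
    | succ m ih => simpa [add_assoc] using hstep _ ih.1 ih.2
  have hE : ∀ i, f '' cycleEdge k t i = cycleEdge k t i := by
    intro i
    have := (hwalk (i - 1).val).2
    rwa [ZMod.natCast_zmod_val, add_sub_cancel] at this
  have hv : ∀ i, f (v i) = v i := by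
    intro i
    have := (hwalk (i - 1 - 1).val).1
    rwa [ZMod.natCast_zmod_val, add_sub_cancel, sub_add_cancel] at this
  have hC : ∀ j, ∀ s < t, ∃ j', ∃ s' < t, f '' colourEdge k t j s = colourEdge k t j' s' := by
    intro j s hs
    rcases mem_edgeSet_cyclicGraph.1 ((hf _).1 (colourEdge_mem (j := j) hs)) with
      ⟨i, h⟩ | h | h
    · have : u i ∈ colourEdge k t j s := hinj (h.trans (hE i).symm) ▸ u_mem_cycleEdge.2 rfl
      simp at this
    · exact h
    · have : x ∈ colourEdge k t j s := hinj (h.trans hex.symm) ▸ x_mem_extraEdge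
      simp at this
  have hu : ∀ i, f (u i) = u i := by
    intro i
    have h1 : f (u i) ∈ cycleEdge k t i := by rw [← hE, hmem]; simp
    cases hfu : f (u i) with
    | v i' =>
      rw [← hv] at hfu
      exact absurd (f.injective hfu) (by simp)
    | u i' => rw [hfu, u_mem_cycleEdge] at h1; rw [h1]
    | x => simp [hfu] at h1
    | w j i' =>
      -- The colour edge at `f (u i)` would be the image of an edge through `u i`, but these
      -- are fixed.
      have hs := blockIndex_lt (by omega) j i'
      obtain ⟨e, he, hfe⟩ := hpre _ (colourEdge_mem (j := j) hs)
      have hue : u i ∈ e := by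
        rw [← hmem, hfe, hfu, w_mem_colourEdge hs]
        simp
      rcases mem_edgeSet_cyclicGraph.1 he with ⟨i'', rfl⟩ | ⟨j', s', hs', rfl⟩ | rfl
      · rw [hE] at hfe
        rw [hfe] at hue
        simp at hue
      · simp at hue
      · rw [hex] at hfe
        rw [hfe] at hue
        simp at hue
  have hw : ∀ j i, ∃ j', f (w j i) = w j' i := by
    intro j i
    have h1 : f (w j i) ∈ cycleEdge k t i := by rw [← hE, hmem]; simp
    cases hfw : f (w j i) with
    | v i' =>
      rw [← hv] at hfw
      exact absurd (f.injective hfw) (by simp)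
    | u i' =>
      rw [← hu] at hfw
      exact absurd (f.injective hfw) (by simp)
    | x => simp [hfw] at h1
    | w j' i' =>
      rw [hfw, w_mem_cycleEdge] at h1
      exact ⟨j', by rw [h1]⟩
  refine Equiv.ext fun a => ?_
  rw [Equiv.Perm.one_apply]
  cases a with
  | v i => exact hv i
  | u i => exact hu i
  | x => exact hx
  | w j i =>
    have hs := blockIndex_lt (by omega) j i
    obtain ⟨j', s', hs', hfC⟩ := hC j _ hs
    have hcol : ∀ i', blockIndex k t j i' = blockIndex k t j i →
        f (w j i') = w j' i' ∧ blockIndex k t j' i' = s' := by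
      intro i' hi'
      obtain ⟨j'', h⟩ := hw j i'
      have h1 : f (w j i') ∈ colourEdge k t j' s' := by
        rw [← hfC, hmem, w_mem_colourEdge hs]
        exact ⟨rfl, hi'⟩
      rw [h, w_mem_colourEdge hs'] at h1
      exact ⟨by rw [h, h1.1], h1.2⟩
    have hjj : j = j' := by
      -- There is a colour, so `k` is at least `4` and there are at least two blocks.
      refine colour_eq_of_blocks_eq (by have := j.2; omega) hs
        fun i' => ⟨fun hi' => (hcol i' hi').2, fun hi' => ?_⟩
      have h1 : w j' i' ∈ f '' colourEdge k t j (blockIndex k t j i) := by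
        rw [hfC, w_mem_colourEdge hs']
        exact ⟨rfl, hi'⟩
      obtain ⟨a, ha, hfa⟩ := h1
      cases a with
      | w j₁ i₁ =>
        obtain ⟨rfl, hi₁⟩ := (w_mem_colourEdge hs).1 ha
        have h2 := (hcol i₁ hi₁).1.symm.trans hfa
        rwa [← ((w.injEq ..).mp h2).2]
      | _ => simp at ha
    rw [(hcol i rfl).1, hjj]

lemma isAsymmetric_cyclicGraph (ht : k - 2 ≤ t) (hn : 3 ≤ t * k) :
    (cyclicGraph k t).IsAsymmetric := by
  intro φ hφ
  let c : (cyclicGraph k t).vertexSet ≃ CyclicVertex k t := Equiv.Set.univ _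
  have h1 : c.permCongr φ = 1 := by
    refine eq_one_of_image_mem_iff ht hn _ fun e => ?_
    have h := hφ (Subtype.val ⁻¹' e)
    have h2 : Subtype.val '' (Subtype.val ⁻¹' e : Set (cyclicGraph k t).vertexSet) = e := by
      rw [Subtype.image_preimage_val]
      exact Set.univ_inter e
    have h3 : Subtype.val '' (φ '' (Subtype.val ⁻¹' e)) = c.permCongr φ '' e := by
      conv_rhs => rw [← h2]
      rw [Set.image_image, Set.image_image]
      rfl
    rwa [h2, h3] at h
  refine Equiv.ext fun a => c.injective ?_
  have := DFunLike.congr_fun h1 (c a)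
  simpa [Equiv.permCongr_apply] using this

theorem isStronglyMinimalAsymmetric_cyclicGraph (hk : 3 ≤ k) (ht : k - 2 ≤ t) :
    (cyclicGraph k t).IsStronglyMinimalAsymmetric k := by
  have hn : 3 ≤ t * k := hk.trans (Nat.le_mul_of_pos_left k (by omega))
  exact ⟨isKGraph_cyclicGraph hk hn, isAsymmetric_cyclicGraph ht hn,
    fun _ _ hsub hne hcard => isSymmetric_of_isSubhypergraph hk ht hsub hne hcard⟩

end Hypergraph

theorem theorem4 (k : ℕ) (hk : 3 ≤ k) :
    (∃ (α : ℕ → Type) (H : ∀ n, Hypergraph (α n)),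
      (∀ n, (H n).IsStronglyMinimalAsymmetric k) ∧
      ∀ m n, m ≠ n → ¬ (H m).Isomorphic (H n)) ∧
    (∀ t : ℕ, k - 2 ≤ t →
      (Hypergraph.cyclicGraph k t).IsStronglyMinimalAsymmetric k ∧
      ∀ a ∈ (Hypergraph.cyclicGraph k t).vertexSet,
        (Hypergraph.cyclicGraph k t).edegree a ≤ 3) ∧
    (∀ s t : ℕ, k - 2 ≤ s → k - 2 ≤ t → s ≠ t →
      ¬ (Hypergraph.cyclicGraph k s).Isomorphic (Hypergraph.cyclicGraph k t)) := by
  refine ⟨⟨_, fun n => Hypergraph.cyclicGraph k (k - 2 + n),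
    fun n => Hypergraph.isStronglyMinimalAsymmetric_cyclicGraph hk (by omega),
    fun m n hmn => Hypergraph.not_isomorphic_cyclicGraph hk (by omega) (by omega) (by omega)⟩,
    fun t ht => ⟨Hypergraph.isStronglyMinimalAsymmetric_cyclicGraph hk ht,
      fun a _ => Hypergraph.edegree_cyclicGraph_le a⟩,
    fun s t hs ht hst => Hypergraph.not_isomorphic_cyclicGraph hk (by omega) (by omega) hst⟩
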